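/- A server is connected to $H\ge 1$ relays, and the relays to $K\ge 1$ users, by a network connection matrix $G\in\{0,1\}^{H\times K}$. Let $\mathcal N_i=\{k\in[K]:G(i,k)=1\}$ be the set of users connected to relay $i$, assume $\bigcup_{i}\mathcal N_i=[K]$, and let $\mathcal I_z$ be the set of users connected to exactly $z$ relays. Communication model. User $k$ holds an intermediate value $\mathbf v_k$ of $V$ bits and sends a message depending on $\mathbf v_k$ to the relays connected to it. From the messages of its users, relay $i$ computes its local intermediate values and a message $X_i$ of $T_i$ bits, which it sends to the server. The server broadcasts to all relays a message $X_0$ of $T_0$ bits that depends on $(X_1,\dots,X_H)$. Each relay must recover $(\mathbf v_1,\dots,\mathbf v_K)$ from $X_0$ and its local values; from the same data it also generates a message to its users, and each user $k$ must recover its updated model $\mathbf w_k$ from the messages of the relays connected to it, where $(\mathbf w_1,\dots,\mathbf w_K)=\phi(\mathbf v_1,\dots,\mathbf v_K)$ for a given, arbitrary global update function $\phi$ (one for each size $V$). A choice of all encoders and decoders is a correct scheme if this works for all values of $\mathbf v_1,\dots,\mathbf v_K$. Its uplink load is $\sum_{i=1}^H T_i/V$ and its downlink load is $T_0/V$. Let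 $L_{\mathrm{up}}^{*}$ and $L_{\mathrm{down}}^{*}$ be the optimal loads, i.e. the infima of the uplink load and of the downlink load, respectively, over all $V\ge 1$ and all correct schemes. Loads of the coded scheme. Put $$L_{\mathrm{up}}=\sum_{z=1}^{H-1}\sum_{i=1}^{H}\alpha_i^z\Bigl(|\mathcal N_i\cap\mathcal I_z|-\min_{j\in[H]}|\mathcal N_i\cap\mathcal N_j\cap\mathcal I_z|\Bigr),\qquad L_{\mathrm{down}}=K-\sum_{z=1}^{H-1}\min_{i\in[H]}|\mathcal N_i\cap\mathcal I_z|,$$ where, for each $z\in[H-1]$, $(\alpha_i^z)_{i\in[H]}$ is an optimal solution of the linear program that minimizes $\sum_{i}\alpha_i^z\bigl(|\mathcal N_i\cap\mathcal I_z|-\min_{j}|\mathcal N_i\cap\mathcal N_j\cap\mathcal I_z|\bigr)$ subject to $\sum_{i:\,k\in\mathcal N_i}\alpha_i^z\ge 1$ for all $k\in\mathcal I_z$ and $0\le\alpha_i^z\le 1$ for all $i\in[H]$. Then $$L_{\mathrm{up}}-L_{\mathrm{up}}^{*}\le\min_{i\in[H]}|\mathcal N_i|-\sum_{z=1}^{H-1}\sum_{i=1}^{H}\frac1z\min_{j\in[H]}|\mathcal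 N_i\cap\mathcal N_j\cap\mathcal I_z|\le\min_{i\in[H]}|\mathcal N_i|,$$ $$L_{\mathrm{down}}-L_{\mathrm{down}}^{*}\le\min_{i\in[H]}|\mathcal N_i|-\sum_{z=1}^{H-1}\min_{i\in[H]}|\mathcal N_i\cap\mathcal I_z|\le\min_{i\in[H]}|\mathcal N_i|.$$ In particular both gaps are at most the minimum number of users connected to any relay. -/

import Mathlib

namespace HierMTL

noncomputable section

/-! ### Network topology -/

/-- `𝒩 i`: the users connected to relay `i`, for the network connection matrix `G`
(`G i k = 1` if relay `i` and user `k` are connected, `G i k = 0` otherwise). -/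
def nbr {H K : ℕ} (G : Matrix (Fin H) (Fin K) ℕ) (i : Fin H) : Finset (Fin K) :=
  Finset.univ.filter fun k => G i k = 1

/-- `r k`: the connectivity of user `k`, i.e. the number of relays that it is connected to. -/
def connectivity {H K : ℕ} (G : Matrix (Fin H) (Fin K) ℕ) (k : Fin K) : ℕ :=
  (Finset.univ.filter fun i => k ∈ nbr G i).card

/-- `ℐ z`: the `z`-connected users, those connected to exactly `z` relays. -/
def zConn {H K : ℕ} (G : Matrix (Fin H) (Fin K) ℕ) (z : ℕ) : Finset (Fin K) :=
  Finset.univ.filter fun k => connectivity G k = z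

/-- `min_i |𝒩 i|`. -/
def minUsers {H K : ℕ} (G : Matrix (Fin H) (Fin K) ℕ) : ℕ :=
  ⨅ i : Fin H, (nbr G i).card

/-- `min_i |𝒩 i ∩ ℐ z|`. -/
def minLocal {H K : ℕ} (G : Matrix (Fin H) (Fin K) ℕ) (z : ℕ) : ℕ :=
  ⨅ i : Fin H, (nbr G i ∩ zConn G z).card

/-- `min_j |𝒩 i ∩ 𝒩 j ∩ ℐ z|`, the minimum being over all relays `j`. -/
def minCommon {H K : ℕ} (G : Matrix (Fin H) (Fin K) ℕ) (z : ℕ) (i : Fin H) : ℕ :=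
  ⨅ j : Fin H, (nbr G i ∩ nbr G j ∩ zConn G z).card

/-! ### Loads of the coded scheme -/

/-- `n i z = |𝒩 i ∩ ℐ z| - min_j |𝒩 i ∩ 𝒩 j ∩ ℐ z|`, the number of combinations that relay `i`
sends in round `z`. -/
def numComb {H K : ℕ} (G : Matrix (Fin H) (Fin K) ℕ) (z : ℕ) (i : Fin H) : ℝ :=
  ((nbr G i ∩ zConn G z).card : ℝ) - (minCommon G z i : ℝ)

/-- Uplink load of round `z` when relay `i` is responsible for a fraction `a i` of each
intermediate value. -/
def roundLoad {H K : ℕ} (G : Matrix (Fin H) (Fin K) ℕ) (z : ℕ) (a : Fin H → ℝ) : ℝ :=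
  ∑ i, a i * numComb G z i

/-- The constraints of the linear program of round `z`: the fractions lie in `[0, 1]`, and every
value of a user in `ℐ z` (the values that round `z` delivers) is completely covered by the relays
that know it. -/
def Feasible {H K : ℕ} (G : Matrix (Fin H) (Fin K) ℕ) (z : ℕ) (a : Fin H → ℝ) : Prop :=
  (∀ k ∈ zConn G z, 1 ≤ ∑ i, if k ∈ nbr G i then a i else 0) ∧ ∀ i, 0 ≤ a i ∧ a i ≤ 1

/-- `a` is an optimal solution of the linear program of round `z`. -/
def IsOptimalSplit {H K : ℕ} (G : Matrix (Fin H) (Fin K) ℕ) (z : ℕ) (a : Fin H → ℝ) : Prop :=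
  Feasible G z a ∧ ∀ b, Feasible G z b → roundLoad G z a ≤ roundLoad G z b

/-- The linear program of every round `z ≥ 1` has an optimal solution. -/
theorem exists_isOptimalSplit {H K : ℕ} (G : Matrix (Fin H) (Fin K) ℕ) {z : ℕ} (hz : 1 ≤ z) :
    ∃ a, IsOptimalSplit G z a := by
  have hcomp : IsCompact {a : Fin H → ℝ | Feasible G z a} := by
    refine IsCompact.of_isClosed_subset (isCompact_Icc (a := (0 : Fin H → ℝ)) (b := 1)) ?_ ?_
    · have h : {a : Fin H → ℝ | Feasible G z a} =
          (⋂ k ∈ zConn G z, {a | 1 ≤ ∑ i, if k ∈ nbr G i then a i else 0}) ∩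
            ⋂ i, {a | 0 ≤ a i ∧ a i ≤ 1} := by
        ext a
        simp [Feasible]
      rw [h]
      refine IsClosed.inter (isClosed_biInter fun k _ => ?_) (isClosed_iInter fun i => ?_)
      · refine isClosed_le continuous_const (continuous_finsetSum _ fun i _ => ?_)
        split_ifs <;> fun_prop
      · exact (isClosed_le continuous_const (continuous_apply i)).inter
          (isClosed_le (continuous_apply i) continuous_const)
    · intro a ha
      exact ⟨fun i => (ha.2 i).1, fun i => (ha.2 i).2⟩
  have hne : {a : Fin H → ℝ | Feasible G z a}.Nonempty := by
    refine ⟨fun _ => 1, fun k hk => ?_, fun i => by norm_num⟩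
    have h : connectivity G k = z := by simpa [zConn] using hk
    rw [← Finset.sum_filter]
    simp only [Finset.sum_const, nsmul_eq_mul, mul_one]
    have : 1 ≤ (Finset.univ.filter fun i => k ∈ nbr G i).card := by
      rw [connectivity] at h
      omega
    exact_mod_cast this
  have hcont : ContinuousOn (roundLoad G z) {a : Fin H → ℝ | Feasible G z a} := by
    unfold roundLoad
    fun_prop
  obtain ⟨a, ha, hmin⟩ := hcomp.exists_isMinOn hne hcont
  exact ⟨a, ha, fun b hb => hmin hb⟩

/-- The uplink load (relays to server) of the coded scheme with fractions `α z i`. -/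
def codedUplinkLoad {H K : ℕ} (G : Matrix (Fin H) (Fin K) ℕ) (α : ℕ → Fin H → ℝ) : ℝ :=
  ∑ z ∈ Finset.Icc 1 (H - 1), roundLoad G z (α z)

/-- The downlink load (server to relays) of the coded scheme. -/
def codedDownlinkLoad {H K : ℕ} (G : Matrix (Fin H) (Fin K) ℕ) : ℝ :=
  (K : ℝ) - ∑ z ∈ Finset.Icc 1 (H - 1), (minLocal G z : ℝ)

/-! ### Communication schemes and optimal loads -/

/-- Messages of `T` bits. -/
abbrev Bits (T : ℕ) : Type := Fin T → Bool

/-- A communication scheme (all encoders and decoders of one iteration) for the network `G` and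
intermediate values of `V` bits. -/
structure Scheme {H K : ℕ} (G : Matrix (Fin H) (Fin K) ℕ) (V : ℕ) where
  /-- number of bits that user `k` sends to its relays -/
  userBits : Fin K → ℕ
  /-- number of bits that relay `i` sends to the server -/
  upBits : Fin H → ℕ
  /-- number of bits that the server broadcasts to the relays -/
  serverBits : ℕ
  /-- number of bits that relay `i` sends to its users -/
  downBits : Fin H → ℕ
  /-- number of local intermediate values stored at relay `i` -/
  localCount : Fin H → ℕ
  /-- encoder of user `k` -/
  userEnc : ∀ k, Bits V → Bits (userBits k)
  /-- local decoder of relay `i`, acting on the messages of its users -/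
  localDec : ∀ i, (∀ k : {k // k ∈ nbr G i}, Bits (userBits k)) → Fin (localCount i) → Bits V
  /-- uplink encoder of relay `i`, acting on the messages of its users -/
  upEnc : ∀ i, (∀ k : {k // k ∈ nbr G i}, Bits (userBits k)) → Bits (upBits i)
  /-- encoder of the server, acting on the uplink messages of all relays -/
  serverEnc : (∀ i, Bits (upBits i)) → Bits serverBits
  /-- decoder of relay `i`, which outputs all `K` intermediate values -/
  relayDec : ∀ i, Bits serverBits → (Fin (localCount i) → Bits V) → Fin K → Bits V
  /-- downlink encoder of relay `i` -/
  downEnc : ∀ i, Bits serverBits → (Fin (localCount i) → Bits V) → Bits (downBits i)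
  /-- decoder of user `k`, acting on the messages of the relays that it is connected to -/
  userDec : ∀ k, (∀ i : {i // k ∈ nbr G i}, Bits (downBits i)) → Bits V

namespace Scheme

/-- The messages that relay `i` receives from its users when the intermediate values are `v`. -/
def received {H K : ℕ} {G : Matrix (Fin H) (Fin K) ℕ} {V : ℕ} (S : Scheme G V)
    (v : Fin K → Bits V) (i : Fin H) : ∀ k : {k // k ∈ nbr G i}, Bits (S.userBits k) :=
  fun k => S.userEnc k (v k)

/-- The local intermediate values of relay `i`. -/
def localVals {H K : ℕ} {G : Matrix (Fin H) (Fin K) ℕ} {V : ℕ} (S : Scheme G V)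
    (v : Fin K → Bits V) (i : Fin H) : Fin (S.localCount i) → Bits V :=
  S.localDec i (S.received v i)

/-- The message that the server broadcasts. -/
def serverMsg {H K : ℕ} {G : Matrix (Fin H) (Fin K) ℕ} {V : ℕ} (S : Scheme G V)
    (v : Fin K → Bits V) : Bits S.serverBits :=
  S.serverEnc fun i => S.upEnc i (S.received v i)

/-- The message that relay `i` sends to its users. -/
def downMsg {H K : ℕ} {G : Matrix (Fin H) (Fin K) ℕ} {V : ℕ} (S : Scheme G V)
    (v : Fin K → Bits V) (i : Fin H) : Bits (S.downBits i) :=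
  S.downEnc i (S.serverMsg v) (S.localVals v i)

/-- The scheme is correct for the global update function `φ`: whatever the intermediate values,
every relay recovers all of them and every user recovers its updated model. -/
def Correct {H K : ℕ} {G : Matrix (Fin H) (Fin K) ℕ} {V : ℕ} (S : Scheme G V)
    (φ : (Fin K → Bits V) → Fin K → Bits V) : Prop :=
  ∀ v : Fin K → Bits V,
    (∀ i, S.relayDec i (S.serverMsg v) (S.localVals v i) = v) ∧
    ∀ k, S.userDec k (fun i => S.downMsg v i) = φ v k

/-- Uplink load from the relays to the server. -/
def uplinkLoad {H K : ℕ} {G : Matrix (Fin H) (Fin K) ℕ} {V : ℕ} (S : Scheme G V) : ℝ :=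
  (∑ i, (S.upBits i : ℝ)) / (V : ℝ)

/-- Downlink load from the server to the relays. -/
def downlinkLoad {H K : ℕ} {G : Matrix (Fin H) (Fin K) ℕ} {V : ℕ} (S : Scheme G V) : ℝ :=
  (S.serverBits : ℝ) / (V : ℝ)

end Scheme

/-- The optimal uplink load: the infimum of the uplink loads of all correct schemes, over all
sizes `V ≥ 1` of the intermediate values. Here `φ V` is the global update function for size `V`. -/
def optUplinkLoad {H K : ℕ} (G : Matrix (Fin H) (Fin K) ℕ)
    (φ : ∀ V : ℕ, (Fin K → Bits V) → Fin K → Bits V) : ℝ :=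
  sInf {L : ℝ | ∃ V : ℕ, 0 < V ∧ ∃ S : Scheme G V, S.Correct (φ V) ∧ L = S.uplinkLoad}

/-- The optimal downlink load: the infimum of the downlink loads of all correct schemes. -/
def optDownlinkLoad {H K : ℕ} (G : Matrix (Fin H) (Fin K) ℕ)
    (φ : ∀ V : ℕ, (Fin K → Bits V) → Fin K → Bits V) : ℝ :=
  sInf {L : ℝ | ∃ V : ℕ, 0 < V ∧ ∃ S : Scheme G V, S.Correct (φ V) ∧ L = S.downlinkLoad}

end

end HierMTL

/-!
A cut-set bound: a relay that knows only the values of its own users must learn all the others from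
the server, so in a correct scheme both the server message and the collection of all uplink messages
carry at least `K - |𝒩 i|` values. Choosing the relay with the fewest users, both optimal loads are
at least `K - min_i |𝒩 i|`.

On the achievability side, each user of `ℐ z` has exactly `z` relays, so giving every relay the
fraction `1 / z` is feasible in the linear program of round `z`. Counting the links of `ℐ z` in two
ways, the load of this split is `|ℐ z| - ∑ i, (1 / z) * min_j |𝒩 i ∩ 𝒩 j ∩ ℐ z|`, and the disjoint
sets `ℐ z` contain at most `K` users altogether.
-/

namespace HierMTL

theorem card_pow_card_le_of_injective_restrict {κ α β : Type*} [Fintype κ] [Fintype α] [Fintype β]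
    (s : Finset κ) {g : (κ → α) → β} (hg : Function.Injective fun v => (s.restrict v, g v)) :
    Fintype.card α ^ Fintype.card κ ≤ Fintype.card α ^ s.card * Fintype.card β := by
  classical
  simpa using Fintype.card_le_of_injective _ hg

theorem card_sub_card_le_div_of_injective_restrict {κ β : Type*} [Fintype κ] [Fintype β] {V T : ℕ}
    (hV : 0 < V) (hβ : Fintype.card β = 2 ^ T) (s : Finset κ) {g : (κ → Bits V) → β}
    (hg : Function.Injective fun v => (s.restrict v, g v)) :
    (Fintype.card κ : ℝ) - s.card ≤ T / V := by
  have hpow : 2 ^ (V * Fintype.card κ) ≤ 2 ^ (V * s.card + T) := by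
    simpa [hβ, pow_mul, pow_add] using card_pow_card_le_of_injective_restrict s hg
  have hbits : V * Fintype.card κ ≤ V * s.card + T := (Nat.pow_le_pow_iff_right one_lt_two).1 hpow
  have hbits' : (V : ℝ) * Fintype.card κ ≤ V * s.card + T := mod_cast hbits
  rw [le_div_iff₀ (by positivity)]
  linarith

variable {H K : ℕ} {G : Matrix (Fin H) (Fin K) ℕ}

namespace Scheme

variable {V : ℕ} {S : Scheme G V} {φ : (Fin K → Bits V) → Fin K → Bits V}

/-- The family of uplink messages that the server receives from the relays when the intermediate
values are `v`; together they have `∑ i, S.upBits i` bits. -/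
def upMsgs (S : Scheme G V) (v : Fin K → Bits V) : ∀ i, Bits (S.upBits i) :=
  fun i => S.upEnc i (S.received v i)

theorem localVals_congr {v w : Fin K → Bits V} {i : Fin H}
    (h : (nbr G i).restrict v = (nbr G i).restrict w) : S.localVals v i = S.localVals w i :=
  congrArg (S.localDec i) <| funext fun k => congrArg (S.userEnc k) (congrFun h k)

theorem Correct.injective_restrict_serverMsg (hS : S.Correct φ) (i : Fin H) :
    Function.Injective fun v => ((nbr G i).restrict v, S.serverMsg v) := by
  intro v w hvw
  obtain ⟨hlocal, hserver⟩ := Prod.mk.inj hvw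
  calc v = S.relayDec i (S.serverMsg v) (S.localVals v i) := ((hS v).1 i).symm
    _ = S.relayDec i (S.serverMsg w) (S.localVals w i) := by rw [hserver, localVals_congr hlocal]
    _ = w := (hS w).1 i

theorem Correct.injective_restrict_upMsgs (hS : S.Correct φ) (i : Fin H) :
    Function.Injective fun v => ((nbr G i).restrict v, S.upMsgs v) :=
  .of_comp (f := Prod.map id S.serverEnc) (hS.injective_restrict_serverMsg i)

theorem Correct.sub_card_nbr_le_downlinkLoad (hV : 0 < V) (hS : S.Correct φ) (i : Fin H) :
    (K : ℝ) - (nbr G i).card ≤ S.downlinkLoad := by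
  simpa [downlinkLoad] using card_sub_card_le_div_of_injective_restrict hV (by simp) _
    (hS.injective_restrict_serverMsg i)

theorem Correct.sub_card_nbr_le_uplinkLoad (hV : 0 < V) (hS : S.Correct φ) (i : Fin H) :
    (K : ℝ) - (nbr G i).card ≤ S.uplinkLoad := by
  have hcard : Fintype.card (∀ j, Bits (S.upBits j)) = 2 ^ ∑ j, S.upBits j := by
    simp [Finset.prod_pow_eq_pow_sum]
  simpa [uplinkLoad] using card_sub_card_le_div_of_injective_restrict hV hcard _
    (hS.injective_restrict_upMsgs i)

end Scheme

section Uncoded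

variable {r : Fin K → Fin H} (hr : ∀ k, k ∈ nbr G (r k)) {V : ℕ}
  (φ : (Fin K → Bits V) → Fin K → Bits V)

/-- The identification of `K` values of `V` bits with a single message of `K * V` bits, which packs
and unpacks the messages of the uncoded scheme. -/
def bitsEquiv (K V : ℕ) : (Fin K → Bits V) ≃ Bits (K * V) :=
  (Equiv.curry (Fin K) (Fin V) Bool).symm.trans (finProdFinEquiv.arrowCongr (Equiv.refl Bool))

/-- The scheme in which every node forwards all that it knows, so that correct schemes exist and
the optimal loads are infima of nonempty sets. The values unknown to a relay are sent as zeros; the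
server reads the value of user `k` from the message of the relay `r k`. -/
def uncodedScheme : Scheme G V where
  userBits _ := V
  upBits _ := K * V
  serverBits := K * V
  downBits _ := K * V
  localCount _ := 0
  userEnc _ x := x
  localDec _ _ _ _ := false
  upEnc i m := bitsEquiv K V fun k => if h : k ∈ nbr G i then m ⟨k, h⟩ else fun _ => false
  serverEnc m := bitsEquiv K V fun k => (bitsEquiv K V).symm (m (r k)) k
  relayDec _ x _ := (bitsEquiv K V).symm x
  downEnc _ x _ := x
  userDec k m := φ ((bitsEquiv K V).symm (m ⟨r k, hr k⟩)) k

theorem serverMsg_uncodedScheme (v : Fin K → Bits V) :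
    (uncodedScheme hr φ).serverMsg v = bitsEquiv K V v := by
  simp [Scheme.serverMsg, Scheme.received, uncodedScheme, hr]

theorem correct_uncodedScheme : (uncodedScheme hr φ).Correct φ := by
  intro v
  have hdecode : (bitsEquiv K V).symm ((uncodedScheme hr φ).serverMsg v) = v :=
    (Equiv.symm_apply_eq _).2 (serverMsg_uncodedScheme hr φ v)
  exact ⟨fun _ => hdecode, fun k => congrArg (φ · k) hdecode⟩

theorem exists_correct_scheme (hcover : ∀ k, ∃ i, k ∈ nbr G i) :
    ∃ S : Scheme G V, S.Correct φ := by
  choose r hr using hcover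
  exact ⟨uncodedScheme hr φ, correct_uncodedScheme hr φ⟩

end Uncoded

theorem sub_card_nbr_le_optUplinkLoad (hcover : ∀ k, ∃ i, k ∈ nbr G i)
    (φ : ∀ V : ℕ, (Fin K → Bits V) → Fin K → Bits V) (i : Fin H) :
    (K : ℝ) - (nbr G i).card ≤ optUplinkLoad G φ := by
  obtain ⟨S, hS⟩ := exists_correct_scheme (φ 1) hcover
  refine le_csInf ⟨_, 1, one_pos, S, hS, rfl⟩ ?_
  rintro _ ⟨V, hV, S, hS, rfl⟩
  exact hS.sub_card_nbr_le_uplinkLoad hV i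

theorem sub_card_nbr_le_optDownlinkLoad (hcover : ∀ k, ∃ i, k ∈ nbr G i)
    (φ : ∀ V : ℕ, (Fin K → Bits V) → Fin K → Bits V) (i : Fin H) :
    (K : ℝ) - (nbr G i).card ≤ optDownlinkLoad G φ := by
  obtain ⟨S, hS⟩ := exists_correct_scheme (φ 1) hcover
  refine le_csInf ⟨_, 1, one_pos, S, hS, rfl⟩ ?_
  rintro _ ⟨V, hV, S, hS, rfl⟩
  exact hS.sub_card_nbr_le_downlinkLoad hV i

variable (G) in
theorem exists_card_nbr_eq_minUsers (hH : 0 < H) : ∃ i, (nbr G i).card = minUsers G :=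
  have : Nonempty (Fin H) := ⟨⟨0, hH⟩⟩
  exists_eq_ciInf_of_finite

theorem mem_zConn {z : ℕ} {k : Fin K} : k ∈ zConn G z ↔ connectivity G k = z := by
  simp [zConn]

section UniformSplit

variable (G)

theorem feasible_one_div {z : ℕ} (hz : 0 < z) : Feasible G z fun _ => 1 / (z : ℝ) := by
  have hz₀ : (z : ℝ) ≠ 0 := mod_cast hz.ne'
  refine ⟨fun k hk => ?_, fun _ => ⟨by positivity, ?_⟩⟩
  · apply le_of_eq
    calc (1 : ℝ) = connectivity G k * (1 / z) := by rw [mem_zConn.1 hk, mul_one_div_cancel hz₀]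
      _ = ∑ i, if k ∈ nbr G i then 1 / (z : ℝ) else 0 := by
        rw [← Finset.sum_filter, Finset.sum_const, nsmul_eq_mul, connectivity]
  · exact div_le_one_of_le₀ (mod_cast hz) (by positivity)

theorem sum_card_nbr_inter_zConn (z : ℕ) :
    ∑ i, (nbr G i ∩ zConn G z).card = z * (zConn G z).card := by
  calc ∑ i, (nbr G i ∩ zConn G z).card
      = ∑ i, ((zConn G z).bipartiteAbove (fun i k => k ∈ nbr G i) i).card := by
        simp only [Finset.bipartiteAbove, Finset.filter_mem_eq_inter, Finset.inter_comm]
    _ = ∑ k ∈ zConn G z, connectivity G k :=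
        Finset.sum_card_bipartiteAbove_eq_sum_card_bipartiteBelow _
    _ = ∑ _k ∈ zConn G z, z := Finset.sum_congr rfl fun _ => mem_zConn.1
    _ = z * (zConn G z).card := by rw [Finset.sum_const, smul_eq_mul, mul_comm]

theorem roundLoad_const (z : ℕ) (c : ℝ) :
    roundLoad G z (fun _ => c) = c * (z * (zConn G z).card) - ∑ i, c * (minCommon G z i : ℝ) := by
  have hcount : ∑ i, ((nbr G i ∩ zConn G z).card : ℝ) = z * (zConn G z).card :=
    mod_cast sum_card_nbr_inter_zConn G z
  simp only [roundLoad, numComb, mul_sub, Finset.sum_sub_distrib, ← Finset.mul_sum, hcount]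

theorem sum_card_zConn_le (s : Finset ℕ) : ∑ z ∈ s, (zConn G z).card ≤ K := by
  calc ∑ z ∈ s, (zConn G z).card = (Finset.univ.filter fun k => connectivity G k ∈ s).card :=
        Finset.sum_card_fiberwise_eq_card_filter _ _ _
    _ ≤ K := (Finset.card_le_univ _).trans_eq (Fintype.card_fin K)

end UniformSplit

theorem IsOptimalSplit.roundLoad_le {z : ℕ} {a : Fin H → ℝ} (ha : IsOptimalSplit G z a)
    (hz : 0 < z) :
    roundLoad G z a ≤ (zConn G z).card - ∑ i, (1 / (z : ℝ)) * (minCommon G z i : ℝ) := by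
  have hz₀ : (z : ℝ) ≠ 0 := mod_cast hz.ne'
  calc roundLoad G z a ≤ roundLoad G z fun _ => 1 / (z : ℝ) := ha.2 _ (feasible_one_div G hz)
    _ = (zConn G z).card - ∑ i, (1 / (z : ℝ)) * (minCommon G z i : ℝ) := by
        rw [roundLoad_const, ← mul_assoc, one_div_mul_cancel hz₀, one_mul]

theorem codedUplinkLoad_le {α : ℕ → Fin H → ℝ}
    (hα : ∀ z ∈ Finset.Icc 1 (H - 1), IsOptimalSplit G z (α z)) :
    codedUplinkLoad G α ≤
      K - ∑ z ∈ Finset.Icc 1 (H - 1), ∑ i, (1 / (z : ℝ)) * (minCommon G z i : ℝ) := by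
  have hK : ∑ z ∈ Finset.Icc 1 (H - 1), ((zConn G z).card : ℝ) ≤ K :=
    mod_cast sum_card_zConn_le G _
  calc codedUplinkLoad G α
      ≤ ∑ z ∈ Finset.Icc 1 (H - 1),
          ((zConn G z).card - ∑ i, (1 / (z : ℝ)) * (minCommon G z i : ℝ)) :=
        Finset.sum_le_sum fun z hz => (hα z hz).roundLoad_le (Finset.mem_Icc.1 hz).1
    _ = ∑ z ∈ Finset.Icc 1 (H - 1), ((zConn G z).card : ℝ) -
          ∑ z ∈ Finset.Icc 1 (H - 1), ∑ i, (1 / (z : ℝ)) * (minCommon G z i : ℝ) :=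
        Finset.sum_sub_distrib _ _
    _ ≤ K - ∑ z ∈ Finset.Icc 1 (H - 1), ∑ i, (1 / (z : ℝ)) * (minCommon G z i : ℝ) := by
        gcongr

end HierMTL

theorem corollary1 {H K : ℕ} (hH : 0 < H) (hK : 0 < K)
    (G : Matrix (Fin H) (Fin K) ℕ)
    (hG : ∀ i k, G i k = 0 ∨ G i k = 1)
    (hcover : ∀ k : Fin K, ∃ i : Fin H, k ∈ HierMTL.nbr G i)
    (φ : ∀ V : ℕ, (Fin K → HierMTL.Bits V) → Fin K → HierMTL.Bits V)
    (α : ℕ → Fin H → ℝ)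
    (hα : ∀ z ∈ Finset.Icc 1 (H - 1), HierMTL.IsOptimalSplit G z (α z)) :
    (HierMTL.codedUplinkLoad G α - HierMTL.optUplinkLoad G φ
        ≤ (HierMTL.minUsers G : ℝ)
          - ∑ z ∈ Finset.Icc 1 (H - 1), ∑ i : Fin H,
              (1 / (z : ℝ)) * (HierMTL.minCommon G z i : ℝ) ∧
      (HierMTL.minUsers G : ℝ)
          - ∑ z ∈ Finset.Icc 1 (H - 1), ∑ i : Fin H,
              (1 / (z : ℝ)) * (HierMTL.minCommon G z i : ℝ)
        ≤ (HierMTL.minUsers G : ℝ)) ∧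
    (HierMTL.codedDownlinkLoad G - HierMTL.optDownlinkLoad G φ
        ≤ (HierMTL.minUsers G : ℝ)
          - ∑ z ∈ Finset.Icc 1 (H - 1), (HierMTL.minLocal G z : ℝ) ∧
      (HierMTL.minUsers G : ℝ)
          - ∑ z ∈ Finset.Icc 1 (H - 1), (HierMTL.minLocal G z : ℝ)
        ≤ (HierMTL.minUsers G : ℝ)) := by
  obtain ⟨i, hi⟩ := HierMTL.exists_card_nbr_eq_minUsers G hH
  have hup : (K : ℝ) - HierMTL.minUsers G ≤ HierMTL.optUplinkLoad G φ :=
    hi ▸ HierMTL.sub_card_nbr_le_optUplinkLoad hcover φ i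
  have hdown : (K : ℝ) - HierMTL.minUsers G ≤ HierMTL.optDownlinkLoad G φ :=
    hi ▸ HierMTL.sub_card_nbr_le_optDownlinkLoad hcover φ i
  have hcoded := HierMTL.codedUplinkLoad_le hα
  refine ⟨⟨by linarith, sub_le_self _ (by positivity)⟩, ?_, sub_le_self _ (by positivity)⟩
  rw [HierMTL.codedDownlinkLoad]
  linarith
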